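/- Let $p>3$ be a prime, $k\ge 1$ an integer, $N=p^{2k}$, and let $C,D$ be integers with $p\nmid C$ and $p\nmid D$. Write $e(x)=e^{2\pi i x}$, let $\left(\frac{\cdot}{p}\right)$ be the Legendre symbol, and equip the space of functions $\psi:\mathbb{Z}/N\to\mathbb{C}$ with $\|\psi\|_2^2=\frac1N\sum_{Q\in\mathbb{Z}/N}|\psi(Q)|^2$ and $\|\psi\|_\infty=\max_{Q}|\psi(Q)|$. Let $U_N$ be the Weil representation of $SL(2,\mathbb{Z}/N)$ on this space, given on generators by $$U_N\begin{pmatrix}1&b\\0&1\end{pmatrix}\psi(x)=e\!\left(\tfrac{r b x^2}{N}\right)\psi(x),\quad U_N\begin{pmatrix}t&0\\0&t^{-1}\end{pmatrix}\psi(x)=\psi(tx),\quad U_N\begin{pmatrix}0&1\\-1&0\end{pmatrix}\psi(x)=\tfrac{1}{\sqrt N}\sum_{y\in\mathbb{Z}/N}\psi(y)\,e\!\left(\tfrac{2rxy}{N}\right),$$ where $2r\equiv 1 \pmod N$. A Hecke eigenfunction is a non-zero $\psi$ that is an eigenfunction of $U_N(h)$ for every $h$ in $$H_D=\left\{\begin{pmatrix}a&bD\\b&a\end{pmatrix}:\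 a,b\in\mathbb{Z}/N,\ a^2-Db^2=1\right\};$$ it is normalized if $\|\psi\|_2=1$. For $x=(x_1,x_2)\in(\mathbb{Z}/N)^2$ put $\zeta_x=\sum_{t\in\mathbb{Z}/p^k}e\!\left(\frac{x_1t}{p^k}\right)\delta_{x_2+p^kt}$, where $\delta_y$ is the indicator function of $\{y\}$; up to a scalar factor $\zeta_x$ depends only on $x$ modulo $p^k$. Let $V_C$ be the linear span of the $\zeta_x$ with $x_1^2-Dx_2^2\equiv -C\pmod{p^k}$. Let $\psi\in V_C$ be a normalized Hecke eigenfunction. If $\left(\frac{C}{p}\right)=-\left(\frac{D}{p}\right)$ or if $k=1$, then $$\frac{2}{\sqrt{1-\left(\frac{D}{p}\right)\frac1p}}\left(1-\frac{\pi^2}{8N}\right)\le\|\psi\|_\infty\le\frac{2}{\sqrt{1-\left(\frac{D}{p}\right)\frac1p}}.$$ -/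

import Mathlib

open scoped MatrixGroups

noncomputable section

namespace CatMap

/-- `L²(ℤ/N)` for `N = p^(2k)`, as a bare space of functions. -/
abbrev State (p k : ℕ) : Type := ZMod (p ^ (2 * k)) → ℂ

/-- `‖ψ‖₂`, for the inner product `⟨φ, ψ⟩ = N⁻¹ ∑ φ(Q) conj(ψ(Q))`, `N = p^(2k)`. -/
def l2Norm (p k : ℕ) [Fact p.Prime] (ψ : State p k) : ℝ :=
  √((1 / (p : ℝ) ^ (2 * k)) * ∑ Q, ‖ψ Q‖ ^ 2)

/-- `‖ψ‖_∞` -/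
def supNorm (p k : ℕ) (ψ : State p k) : ℝ := ⨆ Q, ‖ψ Q‖

/-- Reduction `ℤ/p^(2k) → ℤ/p^k`. -/
def red (p k : ℕ) : ZMod (p ^ (2 * k)) →+* ZMod (p ^ k) :=
  ZMod.castHom (pow_dvd_pow p (by omega)) (ZMod (p ^ k))

/-! ### The Weil representation of `SL(2, ℤ/N)` for `N = p^(2k)`, `p` odd

Here `ZMod.stdAddChar (x : ZMod N)` is `e(x/N) = exp(2πix/N)`, and `2⁻¹` is the inverse of `2`
in `ℤ/N`. Since `N` is an even power of `p`, the constants `Λ(t)` and `S_r(-1, N)`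
(a normalised quadratic Gauss sum) are `1`, and `r = 2⁻¹`. -/

/-- `n_b` -/
def matN (p k : ℕ) (b : ZMod (p ^ (2 * k))) : SL(2, ZMod (p ^ (2 * k))) :=
  ⟨!![1, b; 0, 1], by simp [Matrix.det_fin_two]⟩

/-- `a_t` -/
def matA (p k : ℕ) (t : (ZMod (p ^ (2 * k)))ˣ) : SL(2, ZMod (p ^ (2 * k))) :=
  ⟨!![(t : ZMod (p ^ (2 * k))), 0; 0, ((t⁻¹ : (ZMod (p ^ (2 * k)))ˣ) : ZMod (p ^ (2 * k)))],
    by simp [Matrix.det_fin_two]⟩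

/-- `ω` -/
def matW (p k : ℕ) : SL(2, ZMod (p ^ (2 * k))) :=
  ⟨!![0, 1; -1, 0], by simp [Matrix.det_fin_two]⟩

/-- `(U(n_b) ψ)(x) = e(r b x² / N) ψ(x)` -/
def opN (p k : ℕ) [Fact p.Prime] (b : ZMod (p ^ (2 * k))) : State p k →ₗ[ℂ] State p k where
  toFun ψ := fun x => ZMod.stdAddChar (2⁻¹ * b * x ^ 2) * ψ x
  map_add' f g := by ext x; simp [mul_add]
  map_smul' c f := by ext x; simp [mul_left_comm]

/-- `(U(a_t) ψ)(x) = ψ(t x)` -/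
def opA (p k : ℕ) (t : ZMod (p ^ (2 * k))) : State p k →ₗ[ℂ] State p k where
  toFun ψ := fun x => ψ (t * x)
  map_add' _ _ := rfl
  map_smul' _ _ := rfl

/-- `(U(ω) ψ)(x) = N^(-1/2) ∑_y ψ(y) e(2 r x y / N)` -/
def opW (p k : ℕ) [Fact p.Prime] : State p k →ₗ[ℂ] State p k where
  toFun ψ := fun x => (1 / (p : ℂ) ^ k) * ∑ y, ψ y * ZMod.stdAddChar (2 * 2⁻¹ * x * y)
  map_add' f g := by ext x; simp [add_mul, Finset.sum_add_distrib, mul_add]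
  map_smul' c f := by
    ext x
    simp only [Pi.smul_apply, smul_eq_mul, RingHom.id_apply, mul_assoc, ← Finset.mul_sum]
    ring

/-- The operator `U_N(B)`. For `B = (a, b; c, d)` with `c` a unit we use
`B = n_{a/c} ω n_{cd} a_{-c}`; otherwise `a` is a unit, and
`B = a_{-1} ω (ωB) = a_{-1} ω n_{-c/a} ω n_{ab} a_a`.
By the theorems `weil_mul`, `weil_matN`, `weil_matA`, `weil_matW` below, this is the
representation of `SL(2, ℤ/N)` with the prescribed values on the generators. -/
def weil (p k : ℕ) [Fact p.Prime] (B : SL(2, ZMod (p ^ (2 * k)))) :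
    State p k →ₗ[ℂ] State p k :=
  open Classical in
  if IsUnit (B 1 0) then
    opN p k (B 0 0 * (B 1 0)⁻¹) ∘ₗ opW p k ∘ₗ opN p k (B 1 0 * B 1 1) ∘ₗ opA p k (-B 1 0)
  else
    opA p k (-1) ∘ₗ opW p k ∘ₗ
      opN p k (-B 1 0 * (B 0 0)⁻¹) ∘ₗ opW p k ∘ₗ opN p k (B 0 0 * B 0 1) ∘ₗ opA p k (B 0 0)

/-- `ζ_x = ∑_{t mod p^k} e(x₁ t / p^k) δ_{x₂ + p^k t}`, where `x₁ = x 0` and `x₂ = x 1`. -/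
def zeta (p k : ℕ) [Fact p.Prime] (x : Fin 2 → ZMod (p ^ (2 * k))) : State p k :=
  ∑ t : ZMod (p ^ k), (ZMod.stdAddChar (red p k (x 0) * t) : ℂ) •
    Pi.single (x 1 + (p : ZMod (p ^ (2 * k))) ^ k * (t.val : ZMod (p ^ (2 * k)))) 1

/-- `𝒩(x) = x₁² - D x₂²` on `(ℤ/p^k)²`. -/
def normForm (p k : ℕ) (D : ℤ) (x : Fin 2 → ZMod (p ^ k)) : ZMod (p ^ k) :=
  x 0 ^ 2 - D * x 1 ^ 2

/-- `V_C`, the span of the `ζ_x` with `𝒩(x) = -C` in `ℤ/p^k`. The line `ℂ ζ_x` depends only on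
`x` modulo `p^k`, and `x` runs through all representatives in `(ℤ/N)²`. -/
def VC (p k : ℕ) [Fact p.Prime] (D C : ℤ) : Submodule ℂ (State p k) :=
  Submodule.span ℂ
    {f | ∃ x : Fin 2 → ZMod (p ^ (2 * k)),
      normForm p k D (fun i => red p k (x i)) = -(C : ZMod (p ^ k)) ∧ f = zeta p k x}

/-- `H_D`, the matrices `(a, bD; b, a)` over `ℤ/N` with `a² - D b² = 1`. -/
def HD (p k : ℕ) (D : ℤ) : Set SL(2, ZMod (p ^ (2 * k))) :=
  {h | ∃ a b : ZMod (p ^ (2 * k)), a ^ 2 - D * b ^ 2 = 1 ∧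
    (h : Matrix (Fin 2) (Fin 2) (ZMod (p ^ (2 * k)))) = !![a, b * D; b, a]}

/-- A Hecke eigenfunction: a joint eigenfunction of all the operators `U_N(h)`, `h ∈ H_D`. -/
def IsHeckeEigenfunction (p k : ℕ) [Fact p.Prime] (D : ℤ) (ψ : State p k) : Prop :=
  ψ ≠ 0 ∧ ∀ h ∈ HD p k D, ∃ c : ℂ, weil p k h ψ = c • ψ

/-! ### `weil` is a representation with the prescribed values on the generators -/

theorem red_eq_zero_iff (p k : ℕ) [Fact p.Prime] (a : ZMod (p ^ (2 * k))) :
    red p k a = 0 ↔ (p : ZMod (p ^ (2 * k))) ^ k ∣ a := by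
  obtain ⟨n, rfl⟩ := ZMod.natCast_zmod_surjective a
  constructor
  · intro h
    rw [map_natCast, ZMod.natCast_eq_zero_iff] at h
    obtain ⟨m, rfl⟩ := h
    exact ⟨m, by push_cast; rfl⟩
  · rintro ⟨c, hc⟩
    rw [hc, map_mul, map_pow, map_natCast]
    have : ((p : ZMod (p ^ k)) ^ k) = 0 := by
      have := ZMod.natCast_self (p ^ k)
      push_cast at this
      exact this
    rw [this, zero_mul]

theorem sq_eq_zero_of_dvd (p k : ℕ) {a : ZMod (p ^ (2 * k))}
    (h : (p : ZMod (p ^ (2 * k))) ^ k ∣ a) : a ^ 2 = 0 := by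
  obtain ⟨c, rfl⟩ := h
  have : ((p : ZMod (p ^ (2 * k))) ^ (2 * k)) = 0 := by
    have := ZMod.natCast_self (p ^ (2 * k))
    push_cast at this
    exact this
  rw [mul_pow, ← pow_mul, mul_comm k 2, this, zero_mul]

theorem stdAddChar_mul_pow (p k : ℕ) [Fact p.Prime] (a : ZMod (p ^ (2 * k)))
    (t : ZMod (p ^ k)) :
    (ZMod.stdAddChar (a * ((p : ZMod (p ^ (2 * k))) ^ k * (t.val : ZMod (p ^ (2 * k))))) : ℂ)
      = ZMod.stdAddChar (red p k a * t) := by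
  obtain ⟨n, rfl⟩ := ZMod.natCast_zmod_surjective a
  have hp : (p : ℂ) ≠ 0 := by exact_mod_cast (Fact.out : p.Prime).ne_zero
  have h1 : ((n : ZMod (p ^ (2 * k))) * ((p : ZMod (p ^ (2 * k))) ^ k *
      (t.val : ZMod (p ^ (2 * k))))) = ((n * (p ^ k * t.val) : ℕ) : ℤ) := by
    push_cast; rfl
  have h2 : red p k (n : ZMod (p ^ (2 * k))) * t = ((n * t.val : ℕ) : ℤ) := by
    rw [map_natCast]; push_cast; rw [ZMod.natCast_zmod_val]
  rw [h1, h2, ZMod.stdAddChar_coe, ZMod.stdAddChar_coe]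
  congr 1
  push_cast
  rw [show (p : ℂ) ^ (2 * k) = p ^ k * p ^ k by rw [two_mul, pow_add]]
  field_simp

theorem exists_val_mul (p k : ℕ) [Fact p.Prime] {a : ZMod (p ^ (2 * k))}
    (h : (p : ZMod (p ^ (2 * k))) ^ k ∣ a) :
    ∃ t : ZMod (p ^ k), a = (p : ZMod (p ^ (2 * k))) ^ k * (t.val : ZMod (p ^ (2 * k))) := by
  obtain ⟨c, rfl⟩ := h
  refine ⟨red p k c, ?_⟩
  have h : (p : ZMod (p ^ (2 * k))) ^ k ∣ c - ((red p k c).val : ZMod (p ^ (2 * k))) := by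
    rw [← red_eq_zero_iff, map_sub, map_natCast, ZMod.natCast_zmod_val, sub_self]
  obtain ⟨m, hm⟩ := h
  have := sq_eq_zero_of_dvd p k (dvd_refl ((p : ZMod (p ^ (2 * k))) ^ k))
  linear_combination (p : ZMod (p ^ (2 * k))) ^ k * hm + m * this

theorem val_mul_inj (p k : ℕ) [Fact p.Prime] {s t : ZMod (p ^ k)}
    (h : (p : ZMod (p ^ (2 * k))) ^ k * (s.val : ZMod (p ^ (2 * k)))
      = (p : ZMod (p ^ (2 * k))) ^ k * (t.val : ZMod (p ^ (2 * k)))) : s = t := by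
  have hpos : 0 < p ^ k := pow_pos (Fact.out : p.Prime).pos k
  have h' : ((p ^ k * s.val : ℕ) : ZMod (p ^ (2 * k))) = ((p ^ k * t.val : ℕ) : ZMod _) := by
    push_cast; exact h
  rw [ZMod.natCast_eq_natCast_iff'] at h'
  have lt : ∀ u : ZMod (p ^ k), p ^ k * u.val < p ^ (2 * k) := fun u => by
    rw [two_mul, pow_add]
    exact Nat.mul_lt_mul_of_pos_left (ZMod.val_lt u) hpos
  rw [Nat.mod_eq_of_lt (lt s), Nat.mod_eq_of_lt (lt t)] at h'
  exact ZMod.val_injective _ (Nat.eq_of_mul_eq_mul_left hpos h')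

open Classical in
theorem zeta_apply (p k : ℕ) [Fact p.Prime] (x : Fin 2 → ZMod (p ^ (2 * k)))
    (Q : ZMod (p ^ (2 * k))) :
    zeta p k x Q = if (p : ZMod (p ^ (2 * k))) ^ k ∣ Q - x 1
      then ZMod.stdAddChar (x 0 * (Q - x 1)) else 0 := by
  simp only [zeta, Finset.sum_apply, Pi.smul_apply, smul_eq_mul, Pi.single_apply, mul_ite, mul_one,
    mul_zero]
  split_ifs with h
  · obtain ⟨t, ht⟩ := exists_val_mul p k h
    rw [Finset.sum_eq_single t]
    · rw [if_pos (by rw [← ht]; ring), ht, stdAddChar_mul_pow]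
    · intro s _ hs
      rw [if_neg]
      intro e
      exact hs (val_mul_inj p k (by rw [← ht, e]; ring))
    · simp
  · refine Finset.sum_eq_zero fun t _ => if_neg fun e => h ⟨(t.val : ZMod (p ^ (2 * k))), ?_⟩
    rw [e]; ring

open Classical in
theorem sum_zeta_mul (p k : ℕ) [Fact p.Prime] (x : Fin 2 → ZMod (p ^ (2 * k)))
    (Q : ZMod (p ^ (2 * k))) :
    ∑ y, zeta p k x y * ZMod.stdAddChar (Q * y) = if (p : ZMod (p ^ (2 * k))) ^ k ∣ Q + x 0
      then (p : ℂ) ^ k * ZMod.stdAddChar (Q * x 1) else 0 := by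
  have h1 : ∀ y, zeta p k x y * ZMod.stdAddChar (Q * y) = ∑ t : ZMod (p ^ k),
      if y = x 1 + (p : ZMod (p ^ (2 * k))) ^ k * (t.val : ZMod (p ^ (2 * k))) then
        (ZMod.stdAddChar (red p k (x 0) * t) * ZMod.stdAddChar (Q * y) : ℂ) else 0 := by
    intro y
    simp only [zeta, Finset.sum_apply, Pi.smul_apply, smul_eq_mul, Pi.single_apply, mul_ite,
      mul_one, mul_zero, Finset.sum_mul, ite_mul, zero_mul]
  simp_rw [h1]
  rw [Finset.sum_comm]
  simp only [Finset.sum_ite_eq', Finset.mem_univ, if_true]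
  have h2 : ∀ t : ZMod (p ^ k), (ZMod.stdAddChar (red p k (x 0) * t) * ZMod.stdAddChar
      (Q * (x 1 + (p : ZMod (p ^ (2 * k))) ^ k * (t.val : ZMod (p ^ (2 * k))))) : ℂ)
      = ZMod.stdAddChar (Q * x 1) * ZMod.stdAddChar (t * red p k (Q + x 0)) := by
    intro t
    rw [mul_add, AddChar.map_add_eq_mul, stdAddChar_mul_pow, map_add, mul_add,
      AddChar.map_add_eq_mul, mul_comm t, mul_comm t]
    ring
  simp_rw [h2]
  rw [← Finset.mul_sum, AddChar.sum_mulShift _ (ZMod.isPrimitive_stdAddChar _)]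
  simp only [red_eq_zero_iff, ZMod.card]
  split_ifs
  · push_cast; ring
  · simp

theorem two_inv (p k : ℕ) [Fact p.Prime] (hp : p ≠ 2) :
    (2 : ZMod (p ^ (2 * k))) * 2⁻¹ = 1 := by
  have h : Nat.Coprime 2 (p ^ (2 * k)) :=
    Nat.Coprime.pow_right _ ((Nat.coprime_primes Nat.prime_two Fact.out).2 hp.symm)
  exact_mod_cast ZMod.coe_mul_inv_eq_one 2 h

theorem isUnit_or (p k : ℕ) [Fact p.Prime] (B : SL(2, ZMod (p ^ (2 * k))))
    (h : ¬ IsUnit (B 1 0)) : IsUnit (B 0 0) := by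
  by_contra h'
  have nil : ∀ a : ZMod (p ^ (2 * k)), ¬ IsUnit a → a ^ (2 * k) = 0 := by
    intro a ha
    obtain ⟨n, rfl⟩ := ZMod.natCast_zmod_surjective a
    rw [ZMod.isUnit_iff_coprime] at ha
    have hn : p ∣ n := by
      by_contra hn
      exact ha (Nat.Coprime.pow_right _ ((Nat.Prime.coprime_iff_not_dvd Fact.out).2 hn).symm)
    have := (ZMod.natCast_eq_zero_iff (n ^ (2 * k)) (p ^ (2 * k))).2 (pow_dvd_pow_of_dvd hn _)
    exact_mod_cast this
  have hdet := B.det_coe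
  rw [Matrix.det_fin_two] at hdet
  have n1 : IsNilpotent (B 0 0) := ⟨_, nil _ h'⟩
  have n2 : IsNilpotent (B 1 0) := ⟨_, nil _ h⟩
  have n3 : IsNilpotent (1 : ZMod (p ^ (2 * k))) := by
    rw [← hdet]
    exact (Commute.all _ _).isNilpotent_sub ((Commute.all _ _).isNilpotent_mul_right n1)
      ((Commute.all _ _).isNilpotent_mul_left n2)
  obtain ⟨m, hm⟩ := n3
  rw [one_pow] at hm
  have := subsingleton_of_zero_eq_one hm.symm
  exact h (isUnit_of_subsingleton _)

/-- `T ζ_x = e(r (x₁' x₂' - x₁ x₂) / N) ζ_{x'}` with `x' = g x`, for all `x`. -/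
def Follows (p k : ℕ) [Fact p.Prime] (T : State p k →ₗ[ℂ] State p k)
    (g : Matrix (Fin 2) (Fin 2) (ZMod (p ^ (2 * k)))) : Prop :=
  ∀ x, T (zeta p k x) =
    (ZMod.stdAddChar (2⁻¹ * (g.mulVec x 0 * g.mulVec x 1 - x 0 * x 1)) : ℂ) •
      zeta p k (g.mulVec x)

theorem Follows.comp {p k : ℕ} [Fact p.Prime] {S T : State p k →ₗ[ℂ] State p k}
    {g h : Matrix (Fin 2) (Fin 2) (ZMod (p ^ (2 * k)))}
    (hS : Follows p k S g) (hT : Follows p k T h) : Follows p k (S ∘ₗ T) (g * h) := by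
  intro x
  rw [LinearMap.comp_apply, hT x, map_smul, hS, smul_smul, ← AddChar.map_add_eq_mul,
    Matrix.mulVec_mulVec]
  congr 2
  ring

theorem Follows.unique {p k : ℕ} [Fact p.Prime] {S T : State p k →ₗ[ℂ] State p k}
    {g : Matrix (Fin 2) (Fin 2) (ZMod (p ^ (2 * k)))}
    (hS : Follows p k S g) (hT : Follows p k T g) : S = T := by
  have key : ∀ y : ZMod (p ^ (2 * k)), ∑ s : ZMod (p ^ k), zeta p k ![(s.val : ZMod _), y]
      = ((p : ℂ) ^ k) • Pi.single y 1 := by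
    intro y
    have h1 : ∀ s t : ZMod (p ^ k),
        red p k ((![(s.val : ZMod (p ^ (2 * k))), y] : Fin 2 → ZMod (p ^ (2 * k))) 0) * t
          = s * t := by
      intro s t
      rw [Matrix.cons_val_zero, map_natCast, ZMod.natCast_zmod_val]
    simp only [zeta, h1]
    rw [Finset.sum_comm]
    simp only [Matrix.cons_val_one, Matrix.cons_val_fin_one, ← Finset.sum_smul]
    have h2 : ∀ t : ZMod (p ^ k), ∑ s, (ZMod.stdAddChar (s * t) : ℂ) =
        if t = 0 then (p : ℂ) ^ k else 0 := by
      intro t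
      rw [AddChar.sum_mulShift _ (ZMod.isPrimitive_stdAddChar _)]
      simp [ZMod.card]
    simp_rw [h2]
    simp
  have hp : (p : ℂ) ^ k ≠ 0 := by
    exact_mod_cast pow_ne_zero k (Fact.out : p.Prime).ne_zero
  refine LinearMap.pi_ext' fun y => LinearMap.ext_ring ?_
  have h : (Pi.single y 1 : State p k)
      = ((p : ℂ) ^ k)⁻¹ • ∑ s : ZMod (p ^ k), zeta p k ![(s.val : ZMod _), y] := by
    rw [key, smul_smul, inv_mul_cancel₀ hp, one_smul]
  simp only [LinearMap.comp_apply, LinearMap.coe_single]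
  rw [h, map_smul, map_smul, map_sum, map_sum]
  congr 1
  exact Finset.sum_congr rfl fun s _ => by rw [hS, hT]

theorem follows_opN (p k : ℕ) [Fact p.Prime] (hp : p ≠ 2) (b : ZMod (p ^ (2 * k))) :
    Follows p k (opN p k b) !![1, b; 0, 1] := by
  classical
  intro x
  ext Q
  simp only [opN, LinearMap.coe_mk, AddHom.coe_mk, Pi.smul_apply, smul_eq_mul, zeta_apply]
  simp only [Matrix.mulVec, dotProduct, Fin.sum_univ_two, Matrix.of_apply, Matrix.cons_val_zero,
    Matrix.cons_val_one, Matrix.cons_val', Matrix.cons_val_fin_one, one_mul, zero_mul, zero_add]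
  split_ifs with h
  · rw [← AddChar.map_add_eq_mul, ← AddChar.map_add_eq_mul]
    congr 1
    linear_combination 2⁻¹ * b * sq_eq_zero_of_dvd p k h - b * x 1 * (x 1 - Q) * two_inv p k hp
  · simp

theorem follows_opA (p k : ℕ) [Fact p.Prime] (t : (ZMod (p ^ (2 * k)))ˣ) :
    Follows p k (opA p k t)
      !![(t : ZMod (p ^ (2 * k))), 0; 0, ((t⁻¹ : (ZMod (p ^ (2 * k)))ˣ) : ZMod (p ^ (2 * k)))] := by
  classical
  intro x
  ext Q
  simp only [opA, LinearMap.coe_mk, AddHom.coe_mk, Pi.smul_apply, smul_eq_mul, zeta_apply]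
  simp only [Matrix.mulVec, dotProduct, Fin.sum_univ_two, Matrix.of_apply, Matrix.cons_val_zero,
    Matrix.cons_val_one, Matrix.cons_val', Matrix.cons_val_fin_one, zero_mul, zero_add, add_zero]
  have e : (t : ZMod (p ^ (2 * k))) * Q - x 1
      = t * (Q - ((t⁻¹ : (ZMod (p ^ (2 * k)))ˣ) : ZMod (p ^ (2 * k))) * x 1) := by
    rw [mul_sub, ← mul_assoc, Units.mul_inv, one_mul]
  have e2 : (t : ZMod (p ^ (2 * k))) * x 0 *
      (((t⁻¹ : (ZMod (p ^ (2 * k)))ˣ) : ZMod (p ^ (2 * k))) * x 1) - x 0 * x 1 = 0 := by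
    linear_combination x 0 * x 1 * (Units.mul_inv t)
  rw [e2, mul_zero, AddChar.map_zero_eq_one, one_mul, e]
  simp only [Units.dvd_mul_left]
  split_ifs
  · congr 1; ring
  · rfl

theorem follows_opW (p k : ℕ) [Fact p.Prime] (hp : p ≠ 2) :
    Follows p k (opW p k) !![0, 1; -1, 0] := by
  classical
  intro x
  ext Q
  have hp' : (p : ℂ) ^ k ≠ 0 := by
    exact_mod_cast pow_ne_zero k (Fact.out : p.Prime).ne_zero
  simp only [opW, LinearMap.coe_mk, AddHom.coe_mk, Pi.smul_apply, smul_eq_mul, two_inv p k hp,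
    one_mul, sum_zeta_mul]
  simp only [zeta_apply, Matrix.mulVec, dotProduct, Fin.sum_univ_two, Matrix.of_apply,
    Matrix.cons_val_zero, Matrix.cons_val_one, Matrix.cons_val', Matrix.cons_val_fin_one, zero_mul,
    zero_add, add_zero, neg_mul, one_mul, sub_neg_eq_add]
  split_ifs
  · rw [← AddChar.map_add_eq_mul, ← mul_assoc, one_div, inv_mul_cancel₀ hp', one_mul]
    congr 1
    linear_combination x 0 * x 1 * two_inv p k hp
  · simp

theorem follows_weil (p k : ℕ) [Fact p.Prime] (hp : p ≠ 2) (B : SL(2, ZMod (p ^ (2 * k)))) :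
    Follows p k (weil p k B) B := by
  have hdet := B.det_coe
  rw [Matrix.det_fin_two] at hdet
  unfold weil
  split_ifs with h
  · obtain ⟨c, hc⟩ := h
    have hA := follows_opA p k (-c)
    rw [Units.val_neg, hc] at hA
    have hi : B 1 0 * ((c⁻¹ : (ZMod (p ^ (2 * k)))ˣ) : ZMod (p ^ (2 * k))) = 1 := by
      rw [← hc, Units.mul_inv]
    have key := (follows_opN p k hp (B 0 0 * (B 1 0)⁻¹)).comp ((follows_opW p k hp).comp
      ((follows_opN p k hp (B 1 0 * B 1 1)).comp hA))
    convert key using 1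
    rw [← hc, ZMod.inv_coe_unit, hc, inv_neg, Units.val_neg]
    ext i j
    fin_cases i <;> fin_cases j <;> simp [Matrix.mul_apply, Fin.sum_univ_two]
    · linear_combination (-B 0 0) * hi
    · linear_combination
        ((c⁻¹ : (ZMod (p ^ (2 * k)))ˣ) : ZMod (p ^ (2 * k))) * (-1 : ZMod (p ^ (2 * k))) * hdet
          - B 0 1 * hi - B 0 0 * B 1 1 *
            ((c⁻¹ : (ZMod (p ^ (2 * k)))ˣ) : ZMod (p ^ (2 * k))) * hi
    · linear_combination (-B 1 1) * hi
  · obtain ⟨a, ha⟩ := isUnit_or p k B h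
    have hA := follows_opA p k a
    rw [ha] at hA
    have hm := follows_opA p k (-1)
    rw [Units.val_neg, Units.val_one] at hm
    have hi : B 0 0 * ((a⁻¹ : (ZMod (p ^ (2 * k)))ˣ) : ZMod (p ^ (2 * k))) = 1 := by
      rw [← ha, Units.mul_inv]
    have key := hm.comp ((follows_opW p k hp).comp
      ((follows_opN p k hp (-B 1 0 * (B 0 0)⁻¹)).comp ((follows_opW p k hp).comp
      ((follows_opN p k hp (B 0 0 * B 0 1)).comp hA))))
    convert key using 1
    rw [← ha, ZMod.inv_coe_unit, ha]
    ext i j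
    fin_cases i <;> fin_cases j <;> simp [Matrix.mul_apply, Fin.sum_univ_two]
    · linear_combination (-B 0 1) * hi
    · linear_combination (-B 1 0) * hi
    · linear_combination
        ((a⁻¹ : (ZMod (p ^ (2 * k)))ˣ) : ZMod (p ^ (2 * k))) * hdet - (B 1 1 + B 1 0 * B 0 1 *
          ((a⁻¹ : (ZMod (p ^ (2 * k)))ˣ) : ZMod (p ^ (2 * k)))) * hi

/-- `U_N` is multiplicative. -/
theorem weil_mul (p k : ℕ) [Fact p.Prime] (hp : p ≠ 2) (g h : SL(2, ZMod (p ^ (2 * k)))) :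
    weil p k (g * h) = weil p k g ∘ₗ weil p k h := by
  refine (follows_weil p k hp (g * h)).unique ?_
  rw [Matrix.SpecialLinearGroup.coe_mul]
  exact (follows_weil p k hp g).comp (follows_weil p k hp h)

theorem weil_matN (p k : ℕ) [Fact p.Prime] (hp : p ≠ 2) (b : ZMod (p ^ (2 * k))) :
    weil p k (matN p k b) = opN p k b :=
  (follows_weil p k hp _).unique (follows_opN p k hp b)

theorem weil_matA (p k : ℕ) [Fact p.Prime] (hp : p ≠ 2) (t : (ZMod (p ^ (2 * k)))ˣ) :
    weil p k (matA p k t) = opA p k t :=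
  (follows_weil p k hp _).unique (follows_opA p k t)

theorem weil_matW (p k : ℕ) [Fact p.Prime] (hp : p ≠ 2) :
    weil p k (matW p k) = opW p k :=
  (follows_weil p k hp _).unique (follows_opW p k hp)

theorem weil_one (p k : ℕ) [Fact p.Prime] (hp : p ≠ 2) : weil p k 1 = LinearMap.id := by
  have h : (1 : SL(2, ZMod (p ^ (2 * k)))) = matA p k 1 := by
    ext i j
    fin_cases i <;> fin_cases j <;> simp [matA]
  rw [h, weil_matA p k hp]
  ext f Q
  simp [opA]

end CatMap

end

noncomputable section

/-! ### Counting over finite groups and fields. -/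

namespace CatMap

/-! The functions `ζ_x`, `x` modulo `p^k`, are pairwise orthogonal, and `U_N(h)` sends `ζ_x` to a
phase times `ζ_{hx}`. With `x` read as `x₁ + x₂√D`, the group `H_D` acts by multiplication by
elements of norm one, so it preserves the conic `𝒩(x) = -C` and acts transitively on it, `C` being a
unit. Hence the coefficients of a Hecke eigenfunction in `V_C` all have one modulus on the conic
(`norm_zetaCoeff_eq`) and vanish off it. Plancherel and a point count on the conic give that
modulus: `p^k A` with `A = (1 - (D/p)/p)^(-1/2)` (`norm_zetaCoeff_eq_div_sqrt`).

By Fourier inversion on a coset of `p^k`, `ψ(Q + p^k t)` is `p^(-k)` times the sum of the terms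
`e(st/p^k)` times the coefficient at `(s, Q)`, over the roots of `s² = DQ² - C` modulo `p^k`
(`apply_add_eq_sum_fiber`). The Legendre condition keeps `DQ² - C` a unit; if it fails, `k = 1`, and
a zero value has the single root `0`. So there are at most two terms, each of modulus `A` after the
scaling, whence the upper bound `2A`.

For the lower bound take `Q` with two roots `±s`. As `t` varies, the relative phase `e(-2st/p^k)`
runs through all `p^k`-th roots of unity, so the two terms can be aligned up to an angle `π/p^k`. -/

/-- All fibres of `f` have the cardinality of its kernel. Both cardinalities are kept as factors so
that no division occurs in `ℤ`. -/
theorem card_mul_sum_comp_of_surjective {G H : Type*} [AddGroup G] [AddGroup H] [Fintype G]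
    [Fintype H] (f : G →+ H) (hf : Function.Surjective f) (F : H → ℤ) :
    (Fintype.card H : ℤ) * ∑ g, F (f g) = Fintype.card G * ∑ h, F h := by
  classical
  have hfib : ∀ h, (Finset.univ.filter fun g => f g = h).card
      = (Finset.univ.filter fun g => f g = 0).card := fun h =>
    AddMonoidHom.card_fiber_eq_of_mem_range f (hf h) (hf 0)
  have h1 : ∀ F : H → ℤ, ∑ g, F (f g)
      = (Finset.univ.filter fun g => f g = 0).card * ∑ h, F h := by
    intro F
    rw [← Finset.sum_fiberwise Finset.univ f, Finset.mul_sum]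
    refine Finset.sum_congr rfl fun h _ => ?_
    rw [Finset.sum_congr rfl (g := fun _ => F h), Finset.sum_const, hfib, nsmul_eq_mul]
    intro x hx
    rw [(Finset.mem_filter.1 hx).2]
  have h2 := h1 fun _ => 1
  simp only [Finset.sum_const, Finset.card_univ, nsmul_eq_mul, mul_one] at h2
  rw [h1, h2]
  ring

/-- Grouping by `u = x²`, which has `χ(u) + 1` roots, leaves the sums of `χ(Du - C)` and of
`χ(u)χ(Du - C) = χ(D - C/u)`. Complete affine sums of `χ` vanish; the second sum lacks the value at
`1/u = 0`, which is `χ(D)`. -/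
theorem sum_quadraticChar_mul_sq_sub {F : Type*} [Field F] [Fintype F] [DecidableEq F]
    (hF : ringChar F ≠ 2) {C D : F} (hC : C ≠ 0) (hD : D ≠ 0) :
    ∑ x : F, quadraticChar F (D * x ^ 2 - C) = -quadraticChar F D := by
  have affine : ∀ a b : F, a ≠ 0 → ∑ x, quadraticChar F (a * x + b) = 0 := by
    intro a b ha
    rw [← quadraticChar_sum_zero hF]
    exact Fintype.sum_equiv ((Equiv.mulLeft₀ a ha).trans (Equiv.addRight b)) _ _ fun x => rfl
  have h1 : ∑ x : F, quadraticChar F (D * x ^ 2 - C)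
      = ∑ u : F, (quadraticChar F u + 1) * quadraticChar F (D * u - C) := by
    rw [← Finset.sum_fiberwise Finset.univ fun x : F => x ^ 2]
    refine Finset.sum_congr rfl fun u _ => ?_
    rw [Finset.sum_congr rfl (g := fun _ => quadraticChar F (D * u - C)), Finset.sum_const,
      nsmul_eq_mul, ← quadraticChar_card_sqrts hF]
    · congr 3
      ext x
      simp
    · intro x hx
      rw [← (Finset.mem_filter.1 hx).2]
  -- Since `0⁻¹ = 0`, the term `u = 0` of the completed sum is `χ(D)` and has to be subtracted.
  have h2 : ∀ u : F, (quadraticChar F u + 1) * quadraticChar F (D * u - C)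
      = (quadraticChar F (-C * u⁻¹ + D) - if u = 0 then quadraticChar F D else 0)
        + quadraticChar F (D * u + -C) := by
    intro u
    rcases eq_or_ne u 0 with rfl | hu
    · simp
    · have e : D * u - C = u * (-C * u⁻¹ + D) := by field_simp; ring
      have hs := quadraticChar_sq_one hu
      rw [if_neg hu, ← sub_eq_add_neg, e, map_mul]
      linear_combination quadraticChar F (-C * u⁻¹ + D) * hs
  have h3 : ∑ u : F, quadraticChar F (-C * u⁻¹ + D) = 0 := by
    rw [← affine (-C) D (neg_ne_zero.2 hC)]
    exact Fintype.sum_equiv (Equiv.inv F) _ _ fun x => rfl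
  rw [h1, Finset.sum_congr rfl fun u _ => h2 u, Finset.sum_add_distrib, Finset.sum_sub_distrib, h3,
    affine D _ hD]
  simp

/-- Reduction `ℤ/p^k → ℤ/p`. -/
def redPrime (p k : ℕ) (hk : k ≠ 0) : ZMod (p ^ k) →+* ZMod p :=
  ZMod.castHom (dvd_pow_self p hk) (ZMod p)

theorem redPrime_surjective (p k : ℕ) (hk : k ≠ 0) : Function.Surjective (redPrime p k hk) :=
  ZMod.castHom_surjective _

/-! ### Square roots modulo `p^k`. -/

section

variable {p k : ℕ} [Fact p.Prime] (hk : k ≠ 0)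

theorem redPrime_eq_zero_iff (a : ZMod (p ^ k)) :
    redPrime p k hk a = 0 ↔ (p : ZMod (p ^ k)) ∣ a := by
  obtain ⟨n, rfl⟩ := ZMod.natCast_zmod_surjective a
  constructor
  · intro h
    rw [map_natCast, ZMod.natCast_eq_zero_iff] at h
    exact_mod_cast Nat.cast_dvd_cast h
  · rintro ⟨c, hc⟩
    rw [hc, map_mul, map_natCast, ZMod.natCast_self, zero_mul]

theorem isUnit_iff_redPrime_ne_zero (a : ZMod (p ^ k)) : IsUnit a ↔ redPrime p k hk a ≠ 0 := by
  obtain ⟨n, rfl⟩ := ZMod.natCast_zmod_surjective a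
  rw [ZMod.isUnit_iff_coprime, map_natCast, Ne, ZMod.natCast_eq_zero_iff,
    Nat.coprime_pow_right_iff (Nat.pos_of_ne_zero hk), Nat.coprime_comm,
    Nat.Prime.coprime_iff_not_dvd Fact.out]

/-- In place of Hensel's lemma: `y ≡ 1` modulo `p` gives `y^(p^(k-1)) = 1`, and this exponent is an
odd number `2m + 1`, so `y = (y^(m+1))²`. -/
theorem exists_sq_eq_of_redPrime_eq_one (hp : p ≠ 2) {y : ZMod (p ^ k)}
    (hy : redPrime p k hk y = 1) : ∃ z, y = z ^ 2 := by
  have hd : (p : ZMod (p ^ k)) ∣ y - 1 := by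
    rw [← redPrime_eq_zero_iff hk, map_sub, hy, map_one, sub_self]
  have h := dvd_sub_pow_of_dvd_sub hd (k - 1)
  rw [Nat.sub_add_cancel (Nat.pos_of_ne_zero hk), one_pow] at h
  have h0 : (p : ZMod (p ^ k)) ^ k = 0 := by
    exact_mod_cast ZMod.natCast_self (p ^ k)
  rw [h0, zero_dvd_iff, sub_eq_zero] at h
  obtain ⟨m, hm⟩ := ((Fact.out : p.Prime).odd_of_ne_two hp).pow (n := k - 1)
  refine ⟨y ^ (m + 1), ?_⟩
  rw [hm] at h
  rw [← pow_mul, show (m + 1) * 2 = 2 * m + 1 + 1 by ring, pow_succ, h, one_mul]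

theorem exists_sq_eq_of_redPrime (hp : p ≠ 2) {u : ZMod (p ^ k)} {a : ZMod p} (ha : a ≠ 0)
    (h : redPrime p k hk u = a ^ 2) : ∃ s, redPrime p k hk s ≠ 0 ∧ s ^ 2 = u := by
  obtain ⟨b, rfl⟩ := redPrime_surjective p k hk a
  obtain ⟨c, hc⟩ := (isUnit_iff_redPrime_ne_zero hk b).2 ha
  have hbc : b * (c⁻¹ : (ZMod (p ^ k))ˣ) = 1 := by rw [← hc, Units.mul_inv]
  obtain ⟨z, hz⟩ := exists_sq_eq_of_redPrime_eq_one hk hp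
    (y := u * (c⁻¹ : (ZMod (p ^ k))ˣ) ^ 2) (by
      rw [map_mul, h, ← map_pow, ← map_mul, ← mul_pow, hbc, one_pow, map_one])
  have e : (b * z) ^ 2 = u := by
    rw [mul_pow, ← hz]
    linear_combination u * (b * (c⁻¹ : (ZMod (p ^ k))ˣ) + 1) * hbc
  refine ⟨b * z, fun h0 => ?_, e⟩
  rw [← e, map_pow, h0] at h
  exact ha (pow_eq_zero_iff two_ne_zero |>.1 (by rw [← h]; simp))

/-- The factors of `(t - s)(t + s) = 0` differ by the unit `2s`, so one of them is a unit and the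
other vanishes. -/
theorem sq_eq_sq_iff_of_redPrime_ne_zero (hp : p ≠ 2) {s t : ZMod (p ^ k)}
    (hs : redPrime p k hk s ≠ 0) : t ^ 2 = s ^ 2 ↔ t = s ∨ t = -s := by
  have two : (2 : ZMod p) ≠ 0 := by
    have := ZMod.ringChar_zmod_n p
    exact Ring.two_ne_zero (by rw [this]; exact hp)
  constructor
  · intro h
    have h1 : (t - s) * (t + s) = 0 := by linear_combination h
    by_cases hu : redPrime p k hk (t - s) = 0
    · left
      have : IsUnit (t + s) := by
        rw [isUnit_iff_redPrime_ne_zero hk]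
        rw [map_sub, sub_eq_zero] at hu
        rw [map_add, hu, ← two_mul]
        exact mul_ne_zero two hs
      exact sub_eq_zero.1 ((IsUnit.mul_left_eq_zero this).1 h1)
    · right
      rw [← Ne, ← isUnit_iff_redPrime_ne_zero hk] at hu
      exact eq_neg_of_add_eq_zero_left ((IsUnit.mul_right_eq_zero hu).1 h1)
  · rintro (rfl | rfl) <;> ring

theorem ne_neg_of_redPrime_ne_zero (hp : p ≠ 2) {s : ZMod (p ^ k)}
    (hs : redPrime p k hk s ≠ 0) : s ≠ -s := by
  have two : (2 : ZMod p) ≠ 0 := by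
    have := ZMod.ringChar_zmod_n p
    exact Ring.two_ne_zero (by rw [this]; exact hp)
  intro h
  have := congrArg (redPrime p k hk) (show 2 * s = 0 by linear_combination h)
  rw [map_mul, map_zero, map_ofNat] at this
  exact mul_ne_zero two hs this

/-- The square roots of a unit modulo `p^k` are counted by the quadratic character. -/
theorem card_sqrts_zmod_pow (hp : p ≠ 2) (u : ZMod (p ^ k))
    (hu : redPrime p k hk u ≠ 0 ∨ k = 1) :
    ((Finset.univ.filter fun s : ZMod (p ^ k) => s ^ 2 = u).card : ℤ)
      = 1 + quadraticChar (ZMod p) (redPrime p k hk u) := by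
  by_cases h0 : redPrime p k hk u = 0
  -- A non-unit is admitted only for `k = 1`, where it is `0` and has exactly one root, in agreement
  -- with `1 + χ(0)`.
  · have k1 : k = 1 := hu.resolve_left (not_not.2 h0)
    have z : ∀ a : ZMod (p ^ k), redPrime p k hk a = 0 → a = 0 := by
      intro a ha
      rw [redPrime_eq_zero_iff] at ha
      have hz : (p : ZMod (p ^ k)) ^ k = 0 := by
        exact_mod_cast ZMod.natCast_self (p ^ k)
      subst k1
      rwa [(pow_one (p : ZMod (p ^ 1))).symm.trans hz, zero_dvd_iff] at ha
    have : (Finset.univ.filter fun s : ZMod (p ^ k) => s ^ 2 = u) = {0} := by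
      ext s
      simp only [Finset.mem_filter, Finset.mem_univ, true_and, Finset.mem_singleton, z u h0]
      constructor
      · intro h
        refine z s ?_
        have := congrArg (redPrime p k hk) h
        simpa using this
      · rintro rfl
        simp
    rw [this, h0]
    simp
  · rcases quadraticChar_dichotomy h0 with h | h
    · rw [h]
      obtain ⟨a, ha⟩ := (quadraticChar_one_iff_isSquare h0).1 h
      have ha0 : a ≠ 0 := by
        rintro rfl
        exact h0 (by rw [ha, zero_mul])
      obtain ⟨s, hs, hsu⟩ := exists_sq_eq_of_redPrime hk hp ha0 (by rw [ha, sq])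
      have : (Finset.univ.filter fun s : ZMod (p ^ k) => s ^ 2 = u) = {s, -s} := by
        ext t
        simp [← hsu, sq_eq_sq_iff_of_redPrime_ne_zero hk hp hs]
      rw [this, Finset.card_pair (ne_neg_of_redPrime_ne_zero hk hp hs)]
      norm_num
    · rw [h]
      have : (Finset.univ.filter fun s : ZMod (p ^ k) => s ^ 2 = u) = ∅ := by
        rw [Finset.filter_eq_empty_iff]
        intro s _ hs
        rw [quadraticChar_neg_one_iff_not_isSquare, ← hs, map_pow] at h
        exact h ⟨_, sq _⟩
      rw [this]
      simp

end

/-! ### The functions `ζ_x` and their coefficients. -/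

section

variable {p k : ℕ} [Fact p.Prime]

theorem norm_stdAddChar {n : ℕ} [NeZero n] (a : ZMod n) : ‖(ZMod.stdAddChar a : ℂ)‖ = 1 := by
  rw [ZMod.stdAddChar_apply]; exact Circle.norm_coe _

theorem conj_stdAddChar {n : ℕ} [NeZero n] (a : ZMod n) :
    (starRingEnd ℂ) (ZMod.stdAddChar a) = ZMod.stdAddChar (-a) := by
  rw [ZMod.stdAddChar_apply, ← Circle.coe_inv_eq_conj, ZMod.stdAddChar_apply,
    AddChar.map_neg_eq_inv]

/-- The inner product of `ψ` with `ζ_x`, as a sum over the coset of `x₂`. -/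
def zetaCoeff (p k : ℕ) [Fact p.Prime] (x : Fin 2 → ZMod (p ^ (2 * k))) :
    State p k →ₗ[ℂ] ℂ where
  toFun ψ := ∑ t : ZMod (p ^ k), ZMod.stdAddChar (-(red p k (x 0) * t)) *
    ψ (x 1 + (p : ZMod (p ^ (2 * k))) ^ k * (t.val : ZMod (p ^ (2 * k))))
  map_add' f g := by simp [mul_add, Finset.sum_add_distrib]
  map_smul' c f := by simp [Finset.mul_sum, mul_left_comm]

theorem zetaCoeff_apply (x : Fin 2 → ZMod (p ^ (2 * k))) (ψ : State p k) :
    zetaCoeff p k x ψ = ∑ t : ZMod (p ^ k), ZMod.stdAddChar (-(red p k (x 0) * t)) *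
      ψ (x 1 + (p : ZMod (p ^ (2 * k))) ^ k * (t.val : ZMod (p ^ (2 * k)))) := rfl

theorem zetaCoeff_eq_sum (x : Fin 2 → ZMod (p ^ (2 * k))) (ψ : State p k) :
    zetaCoeff p k x ψ = ∑ Q, ψ Q * (starRingEnd ℂ) (zeta p k x Q) := by
  simp only [zeta, Finset.sum_apply, Pi.smul_apply, smul_eq_mul, Pi.single_apply, mul_ite, mul_one,
    mul_zero, map_sum, Finset.mul_sum, zetaCoeff_apply]
  rw [Finset.sum_comm]
  refine Finset.sum_congr rfl fun t _ => ?_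
  rw [Finset.sum_eq_single
    (x 1 + (p : ZMod (p ^ (2 * k))) ^ k * (t.val : ZMod (p ^ (2 * k))))]
  · rw [if_pos rfl, conj_stdAddChar, mul_comm]
  · intro Q _ hQ
    rw [if_neg hQ, map_zero, mul_zero]
  · simp

theorem red_apply_eq_iff {a b : ZMod (p ^ (2 * k))} :
    red p k a = red p k b ↔ (p : ZMod (p ^ (2 * k))) ^ k ∣ a - b := by
  rw [← red_eq_zero_iff, map_sub, sub_eq_zero]

/-- On the common support `x₁ - y₁` and `Q - x₂` are both multiples of `p^k`, so their product
vanishes modulo `p^(2k)` and the ratio of the two functions is constant. -/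
theorem zeta_congr {x y : Fin 2 → ZMod (p ^ (2 * k))}
    (h : ∀ i, red p k (x i) = red p k (y i)) :
    ∃ c : ℂ, ‖c‖ = 1 ∧ zeta p k x = c • zeta p k y := by
  classical
  refine ⟨ZMod.stdAddChar (y 0 * (y 1 - x 1)), norm_stdAddChar _, ?_⟩
  ext Q
  have h0 := red_apply_eq_iff.1 (h 0)
  have h1 := red_apply_eq_iff.1 (h 1)
  have hiff : (p : ZMod (p ^ (2 * k))) ^ k ∣ Q - x 1 ↔ (p : ZMod (p ^ (2 * k))) ^ k ∣ Q - y 1 := by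
    rw [← red_apply_eq_iff, ← red_apply_eq_iff, h 1]
  rw [Pi.smul_apply, smul_eq_mul, zeta_apply, zeta_apply]
  by_cases hQ : (p : ZMod (p ^ (2 * k))) ^ k ∣ Q - x 1
  · rw [if_pos hQ, if_pos (hiff.1 hQ), ← AddChar.map_add_eq_mul]
    congr 1
    have : (x 0 - y 0) * (Q - x 1) = 0 := by
      obtain ⟨a, ha⟩ := h0
      obtain ⟨b, hb⟩ := hQ
      have := sq_eq_zero_of_dvd p k (dvd_refl ((p : ZMod (p ^ (2 * k))) ^ k))
      rw [ha, hb]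
      linear_combination a * b * this
    linear_combination this
  · rw [if_neg hQ, if_neg (mt hiff.2 hQ), mul_zero]

theorem zetaCoeff_congr {x y : Fin 2 → ZMod (p ^ (2 * k))}
    (h : ∀ i, red p k (x i) = red p k (y i)) (ψ : State p k) :
    ‖zetaCoeff p k x ψ‖ = ‖zetaCoeff p k y ψ‖ := by
  obtain ⟨c, hc, e⟩ := zeta_congr h
  have : zetaCoeff p k x ψ = (starRingEnd ℂ) c * zetaCoeff p k y ψ := by
    rw [zetaCoeff_eq_sum, zetaCoeff_eq_sum, e, Finset.mul_sum]
    refine Finset.sum_congr rfl fun Q _ => ?_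
    rw [Pi.smul_apply, smul_eq_mul, map_mul]
    ring
  rw [this, norm_mul, RCLike.norm_conj, hc, one_mul]

theorem zetaCoeff_zeta_self (x : Fin 2 → ZMod (p ^ (2 * k))) :
    zetaCoeff p k x (zeta p k x) = (p : ℂ) ^ k := by
  classical
  have : ∀ t : ZMod (p ^ k), (ZMod.stdAddChar (-(red p k (x 0) * t)) : ℂ) *
      zeta p k x (x 1 + (p : ZMod (p ^ (2 * k))) ^ k * (t.val : ZMod (p ^ (2 * k)))) = 1 := by
    intro t
    rw [zeta_apply, if_pos ⟨_, add_sub_cancel_left _ _⟩, add_sub_cancel_left, stdAddChar_mul_pow,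
      ← AddChar.map_add_eq_mul, neg_add_cancel, AddChar.map_zero_eq_one]
  rw [zetaCoeff_apply, Finset.sum_congr rfl fun t _ => this t]
  simp [ZMod.card]

/-- Either the supports are different cosets of `p^k`, or the sum is a complete sum of a nontrivial
character of `ℤ/p^k`. -/
theorem zetaCoeff_zeta_of_ne {x y : Fin 2 → ZMod (p ^ (2 * k))}
    (h : ¬ ∀ i, red p k (x i) = red p k (y i)) : zetaCoeff p k x (zeta p k y) = 0 := by
  classical
  rw [zetaCoeff_apply]
  by_cases h1 : red p k (x 1) = red p k (y 1)
  · have h0 : red p k (x 0) ≠ red p k (y 0) := fun h0 => h fun i => by fin_cases i <;> assumption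
    have h1' := red_apply_eq_iff.1 h1
    have : ∀ t : ZMod (p ^ k), (ZMod.stdAddChar (-(red p k (x 0) * t)) : ℂ) *
        zeta p k y (x 1 + (p : ZMod (p ^ (2 * k))) ^ k * (t.val : ZMod (p ^ (2 * k))))
        = ZMod.stdAddChar (y 0 * (x 1 - y 1)) *
          ZMod.stdAddChar (t * (red p k (y 0) - red p k (x 0))) := by
      intro t
      rw [zeta_apply, if_pos, add_sub_right_comm, mul_add, AddChar.map_add_eq_mul,
        stdAddChar_mul_pow, mul_left_comm, ← AddChar.map_add_eq_mul]
      · congr 2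
        ring
      · rw [add_sub_right_comm]
        exact dvd_add h1' ⟨_, rfl⟩
    rw [Finset.sum_congr rfl fun t _ => this t, ← Finset.mul_sum,
      AddChar.sum_mulShift _ (ZMod.isPrimitive_stdAddChar _), if_neg (sub_ne_zero.2 h0.symm)]
    simp
  · refine Finset.sum_eq_zero fun t _ => ?_
    rw [zeta_apply, if_neg, mul_zero]
    rw [red_apply_eq_iff] at h1
    intro hd
    rw [add_sub_right_comm] at hd
    exact h1 ((dvd_add_left ⟨_, rfl⟩).1 hd)

/-! ### The Weil action on coefficients and transitivity on the conic. -/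

theorem red_mulVec_congr {p k : ℕ} (g : Matrix (Fin 2) (Fin 2) (ZMod (p ^ (2 * k))))
    {x y : Fin 2 → ZMod (p ^ (2 * k))} (h : ∀ i, red p k (x i) = red p k (y i)) (i : Fin 2) :
    red p k (g.mulVec x i) = red p k (g.mulVec y i) := by
  simp only [Matrix.mulVec, dotProduct, Fin.sum_univ_two, map_add, map_mul, h]

/-- `U_N(h)` permutes the lines `ℂ ζ_y` by the bijection `y ↦ hy` modulo `p^k`, so orthogonality
gives the claim on each `ζ_y`. The phase depends on `h` and `x` alone, hence linearity extends it to
the span, which contains every `V_C`. -/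
theorem zetaCoeff_weil (hp : p ≠ 2) (h : SL(2, ZMod (p ^ (2 * k))))
    (x : Fin 2 → ZMod (p ^ (2 * k))) :
    ∃ c : ℂ, ‖c‖ = 1 ∧ ∀ ψ ∈ Submodule.span ℂ (Set.range (zeta p k)),
      zetaCoeff p k ((h : Matrix (Fin 2) (Fin 2) _).mulVec x) (weil p k h ψ)
        = c * zetaCoeff p k x ψ := by
  set g := (h : Matrix (Fin 2) (Fin 2) (ZMod (p ^ (2 * k)))) with hg
  refine ⟨ZMod.stdAddChar (2⁻¹ * (g.mulVec x 0 * g.mulVec x 1 - x 0 * x 1)), norm_stdAddChar _,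
    fun ψ hψ => ?_⟩
  induction hψ using Submodule.span_induction with
  | mem f hf =>
    obtain ⟨y, rfl⟩ := hf
    by_cases hxy : ∀ i, red p k (x i) = red p k (y i)
    · obtain ⟨c, -, hc⟩ := zeta_congr fun i => (hxy i).symm
      rw [hc, map_smul, follows_weil p k hp h x, ← hg, map_smul, map_smul, map_smul,
        zetaCoeff_zeta_self, zetaCoeff_zeta_self, smul_eq_mul, smul_eq_mul, smul_eq_mul]
      ring
    · rw [follows_weil p k hp h y, ← hg, map_smul, zetaCoeff_zeta_of_ne hxy, zetaCoeff_zeta_of_ne,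
        smul_zero, mul_zero]
      intro hgxy
      apply hxy
      have := red_mulVec_congr ((h⁻¹ : SL(2, ZMod (p ^ (2 * k)))) : Matrix (Fin 2) (Fin 2) _) hgxy
      simpa only [Matrix.mulVec_mulVec, hg, ← Matrix.SpecialLinearGroup.coe_mul, inv_mul_cancel,
        Matrix.SpecialLinearGroup.coe_one, Matrix.one_mulVec] using this
  | zero => simp
  | add f g _ _ hf hg => rw [map_add, map_add, map_add, hf, hg, mul_add]
  | smul a f _ hf => rw [map_smul, map_smul, map_smul, hf, smul_eq_mul, smul_eq_mul, mul_left_comm]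

/-- `SL(2, ℤ/N)` is finite and `U_N` is multiplicative, so an eigenvalue is a root of unity;
unitarity is not needed. -/
theorem norm_eigenvalue_weil (hp : p ≠ 2) (h : SL(2, ZMod (p ^ (2 * k)))) {ψ : State p k}
    (hψ : ψ ≠ 0) {c : ℂ} (hc : weil p k h ψ = c • ψ) : ‖c‖ = 1 := by
  have hpow : ∀ n : ℕ, weil p k (h ^ n) ψ = c ^ n • ψ := by
    intro n
    induction n with
    | zero => simp [weil_one p k hp]
    | succ n ih =>
      rw [pow_succ, weil_mul p k hp, LinearMap.comp_apply, hc, map_smul, ih, smul_smul, pow_succ']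
  have : Finite SL(2, ZMod (p ^ (2 * k))) := Subtype.finite
  have h1 := hpow (orderOf h)
  rw [pow_orderOf_eq_one, weil_one p k hp, LinearMap.id_apply] at h1
  have h2 : c ^ orderOf h = 1 := by
    by_contra hne
    have : (c ^ orderOf h - 1) • ψ = 0 := by rw [sub_smul, one_smul, ← h1, sub_self]
    rcases smul_eq_zero.1 this with h3 | h3
    · exact hne (sub_eq_zero.1 h3)
    · exact hψ h3
  exact Complex.norm_eq_one_of_pow_eq_one h2 (orderOf_pos h).ne'

theorem VC_le_span (D C : ℤ) : VC p k D C ≤ Submodule.span ℂ (Set.range (zeta p k)) := by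
  refine Submodule.span_mono ?_
  rintro f ⟨x, -, rfl⟩
  exact ⟨x, rfl⟩

theorem zetaCoeff_eq_zero_of_mem_VC {D C : ℤ} {ψ : State p k} (hψ : ψ ∈ VC p k D C)
    {x : Fin 2 → ZMod (p ^ (2 * k))}
    (hx : normForm p k D (fun i => red p k (x i)) ≠ -(C : ZMod (p ^ k))) :
    zetaCoeff p k x ψ = 0 := by
  induction hψ using Submodule.span_induction with
  | mem f hf =>
    obtain ⟨y, hy, rfl⟩ := hf
    refine zetaCoeff_zeta_of_ne fun h => hx ?_
    rw [← hy, funext h]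
  | zero => simp
  | add f g _ _ hf hg => rw [map_add, hf, hg, add_zero]
  | smul a f _ hf => rw [map_smul, hf, smul_zero]

/-- The two entries are the coordinates of the quotient `y/x = y x̄ / 𝒩(x)` in `R[√D]`, with `-v =
1/𝒩(x)`; the norm is multiplicative. -/
theorem norm_quotient_eq_one {R : Type*} [CommRing R] {C D v x₀ x₁ y₀ y₁ : R} (hv : C * v = 1)
    (hx : x₀ ^ 2 - D * x₁ ^ 2 = -C) (hy : y₀ ^ 2 - D * y₁ ^ 2 = -C) :
    (-v * (y₀ * x₀ - D * (y₁ * x₁))) ^ 2 - D * (-v * (y₁ * x₀ - y₀ * x₁)) ^ 2 - 1 = 0 := by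
  linear_combination v ^ 2 * (y₀ ^ 2 - D * y₁ ^ 2) * hx - v ^ 2 * C * hy + (C * v + 1) * hv

/-- One Newton step: `(1 - s/2)² = 1 - s` because `s² = 0`, and `(1 + s)(1 - s) = 1`. -/
theorem norm_rescale_eq_one {R : Type*} [CommRing R] {D a b s i : R} (hi : 2 * i = 1)
    (hs : a ^ 2 - D * b ^ 2 - 1 = s) (hs2 : s ^ 2 = 0) :
    ((1 - i * s) * a) ^ 2 - D * ((1 - i * s) * b) ^ 2 = 1 := by
  have : (1 - i * s) ^ 2 = 1 - s := by linear_combination -s * hi + i ^ 2 * hs2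
  linear_combination (a ^ 2 - D * b ^ 2) * this + (1 - s) * hs - hs2

/-- The group `H_D` acts transitively on the conic `𝒩(x) = -C` over `ℤ/p^k`. -/
theorem exists_mem_HD_mulVec (hp : p ≠ 2) {D C : ℤ} (hC : IsUnit (C : ZMod (p ^ (2 * k))))
    {x y : Fin 2 → ZMod (p ^ (2 * k))}
    (hx : normForm p k D (fun i => red p k (x i)) = -(C : ZMod (p ^ k)))
    (hy : normForm p k D (fun i => red p k (y i)) = -(C : ZMod (p ^ k))) :
    ∃ h ∈ HD p k D, ∀ i,
      red p k ((h : Matrix (Fin 2) (Fin 2) _).mulVec x i) = red p k (y i) := by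
  obtain ⟨u, hu⟩ := hC
  set v : ZMod (p ^ (2 * k)) := ((u⁻¹ : (ZMod (p ^ (2 * k)))ˣ) : ZMod (p ^ (2 * k))) with hv
  have huv : (C : ZMod (p ^ (2 * k))) * v = 1 := by rw [← hu, hv, Units.mul_inv]
  have hCv : (C : ZMod (p ^ k)) * red p k v = 1 := by
    rw [← map_intCast (red p k), ← map_mul, huv, map_one]
  simp only [normForm] at hx hy
  -- The matrix `(a, bD; b, a)` is multiplication by `a + b√D`, here the quotient `y/x`, so it sends
  -- `x` to `y`.
  set a := -v * (y 0 * x 0 - D * (y 1 * x 1)) with ha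
  set b := -v * (y 1 * x 0 - y 0 * x 1) with hb
  have hra : red p k a
      = -red p k v * (red p k (y 0) * red p k (x 0) - D * (red p k (y 1) * red p k (x 1))) := by
    simp [ha]
  have hrb : red p k b
      = -red p k v * (red p k (y 1) * red p k (x 0) - red p k (y 0) * red p k (x 1)) := by
    simp [hb]
  have hab : red p k (a ^ 2 - D * b ^ 2 - 1) = 0 := by
    rw [map_sub, map_sub, map_mul, map_pow, map_pow, map_one, map_intCast, hra, hrb]
    exact norm_quotient_eq_one hCv hx hy
  set s := a ^ 2 - D * b ^ 2 - 1 with hs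
  have hs2 : s ^ 2 = 0 := sq_eq_zero_of_dvd p k ((red_eq_zero_iff p k s).1 hab)
  have h2 := two_inv p k hp
  -- The quotient has norm one only modulo `p^k`, while `H_D` requires it modulo `N`. The factor `w
  -- ≡ 1` modulo `p^k` corrects the norm without changing the action modulo `p^k`.
  set w := (1 : ZMod (p ^ (2 * k))) - 2⁻¹ * s with hw
  have hrw : red p k w = 1 := by rw [hw, map_sub, map_mul, hab, mul_zero, sub_zero, map_one]
  have hw1 : (w * a) ^ 2 - D * (w * b) ^ 2 = 1 := norm_rescale_eq_one h2 hs.symm hs2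
  clear_value w s a b
  refine ⟨⟨!![w * a, w * b * D; w * b, w * a], ?_⟩, ⟨w * a, w * b, hw1, rfl⟩, ?_⟩
  · rw [Matrix.det_fin_two_of, ← hw1]
    ring
  · intro i
    fin_cases i
    · simp only [Matrix.mulVec, dotProduct, Fin.sum_univ_two, Matrix.of_apply,
        Matrix.cons_val_zero, Matrix.cons_val_one, Matrix.cons_val', Matrix.cons_val_fin_one,
        Fin.zero_eta, map_add, map_mul, hrw, map_intCast, hra, hrb]
      linear_combination (-red p k v * red p k (y 0)) * hx + red p k (y 0) * hCv
    · simp only [Matrix.mulVec, dotProduct, Fin.sum_univ_two, Matrix.of_apply,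
        Matrix.cons_val_zero, Matrix.cons_val_one, Matrix.cons_val', Matrix.cons_val_fin_one,
        Fin.mk_one, map_add, map_mul, hrw, hra, hrb]
      linear_combination (-red p k v * red p k (y 1)) * hx + red p k (y 1) * hCv

/-- For `h` taking `x` to `y`, the coefficient of `U_N(h)ψ` at `hx` is the eigenvalue times that of
`ψ` at `hx`, and also a phase times that of `ψ` at `x`. -/
theorem norm_zetaCoeff_eq (hp : p ≠ 2) {D C : ℤ} (hC : IsUnit (C : ZMod (p ^ (2 * k))))
    {ψ : State p k} (hV : ψ ∈ VC p k D C) (hψ : IsHeckeEigenfunction p k D ψ)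
    {x y : Fin 2 → ZMod (p ^ (2 * k))}
    (hx : normForm p k D (fun i => red p k (x i)) = -(C : ZMod (p ^ k)))
    (hy : normForm p k D (fun i => red p k (y i)) = -(C : ZMod (p ^ k))) :
    ‖zetaCoeff p k x ψ‖ = ‖zetaCoeff p k y ψ‖ := by
  obtain ⟨h, hh, hxy⟩ := exists_mem_HD_mulVec hp hC hx hy
  obtain ⟨c, hc⟩ := hψ.2 h hh
  obtain ⟨d, hd, e⟩ := zetaCoeff_weil hp h x
  have e := congrArg norm (e ψ (VC_le_span D C hV))
  rw [hc, map_smul, norm_smul, norm_mul, hd, norm_eigenvalue_weil hp h hψ.1 hc, one_mul,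
    one_mul] at e
  rw [← e, zetaCoeff_congr hxy]

/-! ### Fourier analysis on cosets of `p^k`. -/

/-- Fourier inversion on the coset of `Q`. -/
theorem apply_add_eq_sum_zetaCoeff (ψ : State p k) (Q : ZMod (p ^ (2 * k))) (t : ZMod (p ^ k)) :
    ψ (Q + (p : ZMod (p ^ (2 * k))) ^ k * (t.val : ZMod (p ^ (2 * k))))
      = ((p : ℂ) ^ k)⁻¹ * ∑ s : ZMod (p ^ k), ZMod.stdAddChar (s * t) *
        zetaCoeff p k ![(s.val : ZMod (p ^ (2 * k))), Q] ψ := by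
  have hq : (p : ℂ) ^ k ≠ 0 := by
    exact_mod_cast pow_ne_zero k (Fact.out : p.Prime).ne_zero
  have h1 : ∀ s : ZMod (p ^ k), red p k (s.val : ZMod (p ^ (2 * k))) = s := fun s => by
    rw [map_natCast, ZMod.natCast_zmod_val]
  have h2 : ∀ s u : ZMod (p ^ k), (ZMod.stdAddChar (s * t) : ℂ) * (ZMod.stdAddChar (-(s * u)) *
      ψ (Q + (p : ZMod (p ^ (2 * k))) ^ k * (u.val : ZMod (p ^ (2 * k)))))
      = ZMod.stdAddChar (s * (t - u)) *
        ψ (Q + (p : ZMod (p ^ (2 * k))) ^ k * (u.val : ZMod (p ^ (2 * k)))) := by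
    intro s u
    rw [← mul_assoc, ← AddChar.map_add_eq_mul]
    congr 2
    ring
  simp only [zetaCoeff_apply, Matrix.cons_val_zero, Matrix.cons_val_one, Matrix.cons_val_fin_one,
    h1, Finset.mul_sum, h2]
  rw [Finset.sum_comm]
  simp only [← Finset.mul_sum, ← Finset.sum_mul, AddChar.sum_mulShift _
    (ZMod.isPrimitive_stdAddChar _), sub_eq_zero]
  rw [Finset.sum_eq_single t]
  · rw [if_pos rfl, ZMod.card]
    push_cast
    rw [inv_mul_cancel_left₀ hq]
  · intro u _ hu
    rw [if_neg hu.symm]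
    simp
  · simp

/-- Plancherel on each coset gives one factor `p^k`. The other arises because `Q` runs over all of
`ℤ/N`, so that every coset is met `p^k` times. -/
theorem sum_norm_sq_zetaCoeff (ψ : State p k) :
    ∑ Q, ∑ s : ZMod (p ^ k), ‖zetaCoeff p k ![(s.val : ZMod (p ^ (2 * k))), Q] ψ‖ ^ 2
      = (p : ℝ) ^ k * (p : ℝ) ^ k * ∑ Q, ‖ψ Q‖ ^ 2 := by
  have key : ∀ Q, ∑ s : ZMod (p ^ k), ‖zetaCoeff p k ![(s.val : ZMod (p ^ (2 * k))), Q] ψ‖ ^ 2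
      = (p : ℝ) ^ k * ∑ t : ZMod (p ^ k),
        ‖ψ (Q + (p : ZMod (p ^ (2 * k))) ^ k * (t.val : ZMod (p ^ (2 * k))))‖ ^ 2 := by
    intro Q
    have hq : (p : ℂ) ^ k ≠ 0 := by
      exact_mod_cast pow_ne_zero k (Fact.out : p.Prime).ne_zero
    have hns : ∀ z : ℂ, ((‖z‖ ^ 2 : ℝ) : ℂ) = z * (starRingEnd ℂ) z := fun z => by
      rw [Complex.mul_conj, Complex.normSq_eq_norm_sq]
    apply Complex.ofReal_injective
    rw [Complex.ofReal_sum, Complex.ofReal_mul, Complex.ofReal_sum]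
    simp only [hns]
    push_cast
    set F := fun s : ZMod (p ^ k) => zetaCoeff p k ![(s.val : ZMod (p ^ (2 * k))), Q] ψ with hF
    set f := fun t : ZMod (p ^ k) =>
      ψ (Q + (p : ZMod (p ^ (2 * k))) ^ k * (t.val : ZMod (p ^ (2 * k)))) with hf
    have e1 : ∀ s, (starRingEnd ℂ) (F s)
        = ∑ t, ZMod.stdAddChar (s * t) * (starRingEnd ℂ) (f t) := by
      intro s
      simp only [hF, zetaCoeff_apply, map_sum, map_mul, conj_stdAddChar, neg_neg,
        Matrix.cons_val_zero, map_natCast, ZMod.natCast_zmod_val, Matrix.cons_val_one,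
        Matrix.cons_val_fin_one, hf]
    have e2 : ∀ t, f t = ((p : ℂ) ^ k)⁻¹ * ∑ s, ZMod.stdAddChar (s * t) * F s := fun t =>
      apply_add_eq_sum_zetaCoeff ψ Q t
    change ∑ s, F s * (starRingEnd ℂ) (F s) = (p : ℂ) ^ k * ∑ t, f t * (starRingEnd ℂ) (f t)
    simp only [e1, Finset.mul_sum]
    rw [Finset.sum_comm]
    refine Finset.sum_congr rfl fun t _ => ?_
    have e3 : (p : ℂ) ^ k * f t = ∑ s, ZMod.stdAddChar (s * t) * F s := by
      rw [e2 t, ← mul_assoc, mul_inv_cancel₀ hq, one_mul]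
    rw [← mul_assoc, e3, Finset.sum_mul]
    refine Finset.sum_congr rfl fun s _ => ?_
    ring
  simp only [key]
  rw [← Finset.mul_sum, Finset.sum_comm]
  have shift : ∀ c : ZMod (p ^ (2 * k)), ∑ Q, ‖ψ (Q + c)‖ ^ 2 = ∑ Q, ‖ψ Q‖ ^ 2 := fun c =>
    Fintype.sum_equiv (Equiv.addRight c) _ _ fun _ => rfl
  simp only [shift, Finset.sum_const, Finset.card_univ, ZMod.card, nsmul_eq_mul]
  push_cast
  ring

end

/-- Every unit complex number is within an angle `π/q` of a `q`-th root of unity. -/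
theorem exists_norm_one_add_stdAddChar_mul_ge {q : ℕ} [NeZero q] {z : ℂ} (hz : ‖z‖ = 1) :
    ∃ j : ZMod q, 2 * (1 - Real.pi ^ 2 / (8 * (q : ℝ) ^ 2)) ≤ ‖1 + ZMod.stdAddChar j * z‖ := by
  have hq : (0 : ℝ) < q := by exact_mod_cast NeZero.pos q
  have hpi := Real.pi_pos
  set α := Complex.arg z with hα
  -- `2πm/q` is the multiple of `2π/q` nearest to `arg z`, and `θ` is the remaining angle.
  set m : ℤ := round (α * q / (2 * Real.pi)) with hm
  set θ : ℝ := 2 * Real.pi / q * (α * q / (2 * Real.pi) - m) with hθ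
  have hθ' : θ = α - 2 * Real.pi * m / q := by rw [hθ]; field_simp
  have hzα : z = Complex.exp (α * Complex.I) := by
    have := Complex.norm_mul_exp_arg_mul_I z
    rw [hz, Complex.ofReal_one, one_mul] at this
    exact this.symm
  have e : (ZMod.stdAddChar ((-m : ℤ) : ZMod q) : ℂ) * z = Complex.exp (θ * Complex.I) := by
    rw [ZMod.stdAddChar_coe, hzα, ← Complex.exp_add, hθ']
    congr 1
    push_cast
    ring
  have habs : |θ| ≤ Real.pi / q := by
    rw [hθ, abs_mul, abs_of_pos (by positivity)]
    calc 2 * Real.pi / q * |α * q / (2 * Real.pi) - m| ≤ 2 * Real.pi / q * (1 / 2) :=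
          mul_le_mul_of_nonneg_left (abs_sub_round _) (by positivity)
      _ = Real.pi / q := by ring
  have hsq : θ ^ 2 ≤ Real.pi ^ 2 / (q : ℝ) ^ 2 := by
    rw [← div_pow, ← sq_abs]
    exact pow_le_pow_left₀ (abs_nonneg _) habs 2
  -- Hence the modulus is `2|cos(θ/2)|`, and `cos(θ/2) ≥ 1 - θ²/8` with `|θ| ≤ π/q` yields the
  -- constant.
  have hfac : 1 + Complex.exp (θ * Complex.I)
      = Complex.exp ((θ / 2 : ℝ) * Complex.I) * ((2 * Real.cos (θ / 2) : ℝ) : ℂ) := by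
    push_cast
    rw [Complex.cos, mul_div_cancel₀ _ (two_ne_zero), mul_add, ← Complex.exp_add,
      ← Complex.exp_add, add_comm (1 : ℂ)]
    congr 1
    · congr 1; ring
    · rw [← Complex.exp_zero]; congr 1; ring
  refine ⟨((-m : ℤ) : ZMod q), ?_⟩
  rw [e, hfac, norm_mul, Complex.norm_exp_ofReal_mul_I, one_mul, Complex.norm_real]
  refine le_trans ?_ (le_abs_self _)
  have hcos := Real.one_sub_sq_div_two_le_cos (x := θ / 2)
  have : Real.pi ^ 2 / (8 * (q : ℝ) ^ 2) = Real.pi ^ 2 / (q : ℝ) ^ 2 / 8 := by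
    field_simp
  rw [this]
  linarith

/-! ### Counting points on the conic and the size of the coefficients. -/

section

variable {p k : ℕ} [Fact p.Prime]

theorem isUnit_intCast {n : ℕ} {C : ℤ} (hC : ¬ (p : ℤ) ∣ C) : IsUnit (C : ZMod (p ^ n)) := by
  rw [ZMod.coe_int_isUnit_iff_isCoprime]
  push_cast
  exact IsCoprime.pow_left ((Prime.coprime_iff_not_dvd (Nat.prime_iff_prime_int.1 Fact.out)).2 hC)

/-- The reduction `ℤ/p^(2k) → ℤ/p`. -/
def redToPrime (p k : ℕ) (hk : k ≠ 0) : ZMod (p ^ (2 * k)) →+* ZMod p :=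
  (redPrime p k hk).comp (red p k)

theorem redToPrime_surjective (p k : ℕ) (hk : k ≠ 0) :
    Function.Surjective (redToPrime p k hk) :=
  (redPrime_surjective p k hk).comp (ZMod.castHom_surjective _)

/-- The values `x₁` for which `(x₁, Q)` lies on the conic `𝒩(x) = -C`. -/
def fiber (p k : ℕ) [Fact p.Prime] (D C : ℤ) (Q : ZMod (p ^ (2 * k))) : Finset (ZMod (p ^ k)) :=
  Finset.univ.filter fun s => s ^ 2 = D * red p k Q ^ 2 - C

theorem mem_fiber {D C : ℤ} {Q : ZMod (p ^ (2 * k))} {s : ZMod (p ^ k)} :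
    s ∈ fiber p k D C Q ↔ normForm p k D
      (fun i => red p k ((![(s.val : ZMod (p ^ (2 * k))), Q] : Fin 2 → ZMod (p ^ (2 * k))) i))
        = -(C : ZMod (p ^ k)) := by
  simp only [fiber, normForm, Finset.mem_filter, Finset.mem_univ, true_and, Matrix.cons_val_zero,
    Matrix.cons_val_one, Matrix.cons_val_fin_one, map_natCast, ZMod.natCast_zmod_val]
  constructor <;> intro h <;> linear_combination h

/-- A zero would make `C` equal to `D` times a nonzero square, so `C` and `D` would have the same
nonzero Legendre symbol. -/
theorem mul_sq_sub_ne_zero {C D : ℤ} (hC : ¬ (p : ℤ) ∣ C)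
    (h : legendreSym p C = -legendreSym p D) (x : ZMod p) : (D : ZMod p) * x ^ 2 - C ≠ 0 := by
  intro h0
  have hC0 : (C : ZMod p) ≠ 0 := by rwa [Ne, ZMod.intCast_zmod_eq_zero_iff_dvd]
  have e : (C : ZMod p) = D * x ^ 2 := (sub_eq_zero.1 h0).symm
  have hx : x ≠ 0 := by
    rintro rfl
    exact hC0 (by rw [e]; simp)
  have h1 : legendreSym p C = legendreSym p D := by
    rw [legendreSym, e, map_mul, quadraticChar_sq_one' hx, mul_one, legendreSym]
  have h2 := legendreSym.sq_one p hC0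
  have h3 : legendreSym p C = 0 := by omega
  rw [h3] at h2
  norm_num at h2

theorem card_fiber (hp : p ≠ 2) (hk : k ≠ 0) {C D : ℤ} (hC : ¬ (p : ℤ) ∣ C)
    (h : legendreSym p C = -legendreSym p D ∨ k = 1) (Q : ZMod (p ^ (2 * k))) :
    ((fiber p k D C Q).card : ℤ)
      = 1 + quadraticChar (ZMod p) (D * redToPrime p k hk Q ^ 2 - C) := by
  have e : redPrime p k hk (D * red p k Q ^ 2 - C) = D * redToPrime p k hk Q ^ 2 - C := by
    simp [redToPrime]
  rw [fiber, card_sqrts_zmod_pow hk hp, e]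
  refine h.imp (fun h => ?_) id
  rw [e]
  exact mul_sq_sub_ne_zero hC h _

theorem ringChar_ne_two (hp : p ≠ 2) : ringChar (ZMod p) ≠ 2 := by
  rwa [ZMod.ringChar_zmod_n]

theorem sum_one_add_quadraticChar (hp : p ≠ 2) {C D : ℤ} (hC : ¬ (p : ℤ) ∣ C)
    (hD : ¬ (p : ℤ) ∣ D) :
    ∑ x : ZMod p, (1 + quadraticChar (ZMod p) (D * x ^ 2 - C)) = p - legendreSym p D := by
  rw [Finset.sum_add_distrib, sum_quadraticChar_mul_sq_sub (ringChar_ne_two hp), legendreSym]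
  · simp [ZMod.card, sub_eq_add_neg]
  · rwa [Ne, ZMod.intCast_zmod_eq_zero_iff_dvd]
  · rwa [Ne, ZMod.intCast_zmod_eq_zero_iff_dvd]

/-- The fibre count depends only on `Q` modulo `p`, so the sum is a multiple of the number `p -
(D/p)` of points on the conic over `ℤ/p`. -/
theorem sum_card_fiber (hp : p ≠ 2) (hk : k ≠ 0) {C D : ℤ} (hC : ¬ (p : ℤ) ∣ C)
    (hD : ¬ (p : ℤ) ∣ D) (h : legendreSym p C = -legendreSym p D ∨ k = 1) :
    (p : ℤ) * ∑ Q, ((fiber p k D C Q).card : ℤ) = p ^ (2 * k) * (p - legendreSym p D) := by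
  have := card_mul_sum_comp_of_surjective (redToPrime p k hk).toAddMonoidHom
    (redToPrime_surjective p k hk) fun x => 1 + quadraticChar (ZMod p) (D * x ^ 2 - C)
  rw [sum_one_add_quadraticChar hp hC hD, ZMod.card, ZMod.card] at this
  simp only [card_fiber hp hk hC h]
  push_cast at this
  exact this

/-- Otherwise only zeros of `Dx² - C`, at most two, would contribute to the point count, each
contributing one; but that count is at least `p - 1 > 2`. -/
theorem exists_quadraticChar_eq_one (hp : 3 < p) {C D : ℤ} (hC : ¬ (p : ℤ) ∣ C)
    (hD : ¬ (p : ℤ) ∣ D) : ∃ x : ZMod p, quadraticChar (ZMod p) (D * x ^ 2 - C) = 1 := by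
  by_contra! hne
  have hD0 : (D : ZMod p) ≠ 0 := by rwa [Ne, ZMod.intCast_zmod_eq_zero_iff_dvd]
  have hsum := sum_one_add_quadraticChar (by omega) hC hD
  have hle : ∀ x : ZMod p, 1 + quadraticChar (ZMod p) (D * x ^ 2 - C)
      ≤ if x ^ 2 = C / D then 1 else 0 := by
    intro x
    split_ifs with hx
    · rw [hx, mul_div_cancel₀ _ hD0, sub_self, MulChar.map_zero, add_zero]
    · have h0 : (D : ZMod p) * x ^ 2 - C ≠ 0 := fun h0 => hx (by
        rw [eq_div_iff hD0]; linear_combination h0)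
      rw [(quadraticChar_dichotomy h0).resolve_left (hne x)]
      norm_num
  have h1 := Finset.sum_le_sum fun x (_ : x ∈ Finset.univ) => hle x
  have hcard := quadraticChar_card_sqrts (ringChar_ne_two (p := p) (by omega)) ((C : ZMod p) / D)
  have hset : ((Finset.univ.filter fun x : ZMod p => x ^ 2 = C / D).card : ℤ)
      = quadraticChar (ZMod p) ((C : ZMod p) / D) + 1 := by
    rw [← hcard]
    congr 2
    ext x
    simp
  have hbound : ∀ a : ZMod p, quadraticChar (ZMod p) a ≤ 1 := by
    intro a
    rcases eq_or_ne a 0 with rfl | ha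
    · simp
    · rcases quadraticChar_dichotomy ha with h | h <;> simp [h]
  rw [hsum, Finset.sum_ite, Finset.sum_const_zero, add_zero, Finset.sum_const, nsmul_eq_mul,
    mul_one, hset, legendreSym] at h1
  have := hbound ((C : ZMod p) / D)
  have := hbound (D : ZMod p)
  omega

theorem legendreSym_le_one (D : ℤ) : legendreSym p D ≤ 1 := by
  rw [legendreSym]
  rcases eq_or_ne (D : ZMod p) 0 with h | h
  · rw [h]; simp
  · rcases quadraticChar_dichotomy h with h | h <;> simp [h]

/-- The modulus of the coefficients of a normalised Hecke eigenfunction on the conic. -/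
theorem norm_zetaCoeff_eq_div_sqrt (hp : 3 < p) (hk : k ≠ 0) {C D : ℤ} (hC : ¬ (p : ℤ) ∣ C)
    (hD : ¬ (p : ℤ) ∣ D) {ψ : State p k} (hV : ψ ∈ VC p k D C)
    (hψ : IsHeckeEigenfunction p k D ψ) (hnorm : l2Norm p k ψ = 1)
    (h : legendreSym p C = -legendreSym p D ∨ k = 1)
    {x : Fin 2 → ZMod (p ^ (2 * k))}
    (hx : normForm p k D (fun i => red p k (x i)) = -(C : ZMod (p ^ k))) :
    ‖zetaCoeff p k x ψ‖
      = (p : ℝ) ^ k * (1 / √(1 - (legendreSym p D : ℝ) * (1 / (p : ℝ)))) := by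
  have hp2 : p ≠ 2 := by omega
  have hp0 : (0 : ℝ) < p := by exact_mod_cast (Fact.out : p.Prime).pos
  set B := ‖zetaCoeff p k x ψ‖ with hB
  have h1 := sum_norm_sq_zetaCoeff ψ
  have h2 : ∀ Q, ∑ s : ZMod (p ^ k), ‖zetaCoeff p k ![(s.val : ZMod (p ^ (2 * k))), Q] ψ‖ ^ 2
      = (fiber p k D C Q).card * B ^ 2 := by
    intro Q
    rw [← nsmul_eq_mul, ← Finset.sum_const]
    symm
    refine Finset.sum_subset_zero_on_sdiff (Finset.subset_univ _) ?_ ?_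
    · intro s hs
      rw [Finset.mem_sdiff, mem_fiber] at hs
      rw [zetaCoeff_eq_zero_of_mem_VC hV hs.2]
      simp
    · intro s hs
      rw [hB, norm_zetaCoeff_eq hp2 (isUnit_intCast hC) hV hψ hx (mem_fiber.1 hs)]
  rw [Finset.sum_congr rfl fun Q _ => h2 Q, ← Finset.sum_mul] at h1
  have h3 : (p : ℝ) * ∑ Q, ((fiber p k D C Q).card : ℝ)
      = p ^ (2 * k) * (p - legendreSym p D) := by
    exact_mod_cast sum_card_fiber hp2 hk hC hD h
  have h4 : ∑ Q, ‖ψ Q‖ ^ 2 = (p : ℝ) ^ (2 * k) := by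
    rw [l2Norm, Real.sqrt_eq_one, one_div, inv_mul_eq_one₀ (by positivity)] at hnorm
    exact hnorm.symm
  have hχ : (legendreSym p D : ℝ) ≤ 1 := by exact_mod_cast legendreSym_le_one D
  have hp1 : (1 : ℝ) < p := by exact_mod_cast (Fact.out : p.Prime).one_lt
  have hpos : 0 < 1 - (legendreSym p D : ℝ) * (1 / (p : ℝ)) := by
    rw [mul_one_div, sub_pos, div_lt_one hp0]
    linarith
  have hpow : (p : ℝ) ^ (2 * k) ≠ 0 := by positivity
  -- Plancherel reads `B² ∑ #fiber = p^(2k) · p^(2k)`, and the fibre sizes add up to `p^(2k) (1 -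
  -- (D/p)/p)`.
  have h5 : B ^ 2 * (1 - (legendreSym p D : ℝ) * (1 / (p : ℝ))) = ((p : ℝ) ^ k) ^ 2 := by
    rw [h4] at h1
    have h6 : (p : ℝ) ^ (2 * k) * (B ^ 2 * (p - legendreSym p D))
        = p ^ (2 * k) * (p * ((p : ℝ) ^ k) ^ 2) := by
      linear_combination (p : ℝ) * h1 - B ^ 2 * h3
    have h7 := mul_left_cancel₀ hpow h6
    field_simp
    linear_combination h7
  rw [mul_one_div, eq_div_iff (Real.sqrt_pos.2 hpos).ne']
  refine (pow_left_inj₀ (by positivity) (by positivity) two_ne_zero).1 ?_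
  rw [mul_pow, Real.sq_sqrt hpos.le, h5]

theorem apply_add_eq_sum_fiber {C D : ℤ} {ψ : State p k} (hV : ψ ∈ VC p k D C)
    (Q : ZMod (p ^ (2 * k))) (t : ZMod (p ^ k)) :
    ψ (Q + (p : ZMod (p ^ (2 * k))) ^ k * (t.val : ZMod (p ^ (2 * k))))
      = ((p : ℂ) ^ k)⁻¹ * ∑ s ∈ fiber p k D C Q, ZMod.stdAddChar (s * t) *
        zetaCoeff p k ![(s.val : ZMod (p ^ (2 * k))), Q] ψ := by
  rw [apply_add_eq_sum_zetaCoeff ψ Q t]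
  congr 1
  symm
  refine Finset.sum_subset (Finset.subset_univ _) fun s _ hs => ?_
  rw [mem_fiber] at hs
  rw [zetaCoeff_eq_zero_of_mem_VC hV hs, mul_zero]

end

end CatMap

end

/-! ### The two bounds for the sup norm. -/

theorem mainTheorem7 (p k : ℕ) [Fact p.Prime] (hp : 3 < p) (hk : 1 ≤ k) (C D : ℤ)
    (hC : ¬ (p : ℤ) ∣ C) (hD : ¬ (p : ℤ) ∣ D)
    (ψ : ZMod (p ^ (2 * k)) → ℂ) (hV : ψ ∈ CatMap.VC p k D C)
    (hψ : CatMap.IsHeckeEigenfunction p k D ψ) (hnorm : CatMap.l2Norm p k ψ = 1)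
    (h : legendreSym p C = -legendreSym p D ∨ k = 1) :
    2 / √(1 - (legendreSym p D : ℝ) * (1 / (p : ℝ))) *
        (1 - Real.pi ^ 2 / (8 * (p : ℝ) ^ (2 * k))) ≤ CatMap.supNorm p k ψ ∧
      CatMap.supNorm p k ψ ≤ 2 / √(1 - (legendreSym p D : ℝ) * (1 / (p : ℝ))) := by
  have hk0 : k ≠ 0 := by omega
  have hp2 : p ≠ 2 := by omega
  have hp0 : (0 : ℝ) < p := by exact_mod_cast (Fact.out : p.Prime).pos
  have hq0 : ((p : ℝ) ^ k) ≠ 0 := by positivity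
  have coeff := fun (Q : ZMod (p ^ (2 * k))) (s : ZMod (p ^ k))
    (hs : s ∈ CatMap.fiber p k D C Q) =>
      CatMap.norm_zetaCoeff_eq_div_sqrt hp hk0 hC hD hV hψ hnorm h (CatMap.mem_fiber.1 hs)
  set A : ℝ := 1 / √(1 - (legendreSym p D : ℝ) * (1 / (p : ℝ))) with hA
  have hA2 : 2 / √(1 - (legendreSym p D : ℝ) * (1 / (p : ℝ))) = 2 * A := by rw [hA]; ring
  have hA0 : 0 ≤ A := by positivity
  have hnq : ‖((p : ℂ) ^ k)⁻¹‖ = ((p : ℝ) ^ k)⁻¹ := by simp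
  rw [hA2]
  constructor
  · obtain ⟨x, hx⟩ := CatMap.exists_quadraticChar_eq_one hp hC hD
    obtain ⟨Q, rfl⟩ := CatMap.redToPrime_surjective p k hk0 x
    have hcard : (CatMap.fiber p k D C Q).card = 2 := by
      have := CatMap.card_fiber hp2 hk0 hC h Q
      rw [hx] at this
      exact_mod_cast this
    have hne : (D : ZMod p) * CatMap.redToPrime p k hk0 Q ^ 2 - C ≠ 0 := by
      intro h0
      rw [h0, MulChar.map_zero] at hx
      exact zero_ne_one hx
    obtain ⟨s, hs⟩ : (CatMap.fiber p k D C Q).Nonempty := by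
      rw [← Finset.card_pos, hcard]
      norm_num
    have hsq : s ^ 2 = D * CatMap.red p k Q ^ 2 - C := (Finset.mem_filter.1 hs).2
    have hs0 : CatMap.redPrime p k hk0 s ≠ 0 := by
      intro h0
      apply hne
      have := congrArg (CatMap.redPrime p k hk0) hsq
      rw [map_pow, h0] at this
      simpa [CatMap.redToPrime] using this.symm
    have hs' : -s ∈ CatMap.fiber p k D C Q := by
      rw [CatMap.fiber, Finset.mem_filter]
      exact ⟨Finset.mem_univ _, by rw [neg_sq, hsq]⟩
    have hss := CatMap.ne_neg_of_redPrime_ne_zero hk0 hp2 hs0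
    have hfib : CatMap.fiber p k D C Q = {s, -s} := by
      symm
      refine Finset.eq_of_subset_of_card_le ?_ (by rw [hcard, Finset.card_pair hss])
      intro t ht
      rw [Finset.mem_insert, Finset.mem_singleton] at ht
      rcases ht with rfl | rfl <;> assumption
    set F := CatMap.zetaCoeff p k ![(s.val : ZMod (p ^ (2 * k))), Q] ψ with hF
    set G := CatMap.zetaCoeff p k ![((-s).val : ZMod (p ^ (2 * k))), Q] ψ with hG
    have hFn : ‖F‖ = (p : ℝ) ^ k * A := coeff Q s hs
    have hGn : ‖G‖ = (p : ℝ) ^ k * A := coeff Q (-s) hs'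
    -- If the common modulus were zero, Fourier inversion would give `ψ = 0`.
    have hApos : ‖F‖ ≠ 0 := by
      rw [hFn]
      refine mul_ne_zero hq0 fun hA' => ?_
      apply hψ.1
      ext R
      have := CatMap.apply_add_eq_sum_fiber hV R 0
      rw [ZMod.val_zero, Nat.cast_zero, mul_zero, add_zero] at this
      rw [this, Finset.sum_eq_zero, mul_zero, Pi.zero_apply]
      intro t ht
      have := coeff R t ht
      rw [hA', mul_zero, norm_eq_zero] at this
      rw [this, mul_zero]
    have hF0 : F ≠ 0 := norm_ne_zero_iff.1 hApos
    obtain ⟨j, hj⟩ := CatMap.exists_norm_one_add_stdAddChar_mul_ge (q := p ^ k) (z := G / F)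
      (by rw [norm_div, hFn, hGn, div_self (hFn ▸ hApos)])
    -- The terms at `s` and `-s` have relative phase `e(-2st/p^k)`; as `-2s` is a unit, some `t`
    -- realises the required `j = -2st`.
    have hu : IsUnit (-2 * s) := by
      rw [CatMap.isUnit_iff_redPrime_ne_zero hk0, map_mul, map_neg, map_ofNat]
      refine mul_ne_zero (neg_ne_zero.2 ?_) hs0
      exact Ring.two_ne_zero (CatMap.ringChar_ne_two hp2)
    obtain ⟨t, ht⟩ := hu.dvd (a := j)
    have hval := CatMap.apply_add_eq_sum_fiber hV Q t
    rw [hfib, Finset.sum_pair hss, ← hF, ← hG] at hval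
    have hfac : (ZMod.stdAddChar (s * t) : ℂ) * F + ZMod.stdAddChar (-s * t) * G
        = ZMod.stdAddChar (s * t) * F * (1 + ZMod.stdAddChar j * (G / F)) := by
      have : (ZMod.stdAddChar (-s * t) : ℂ)
          = ZMod.stdAddChar (s * t) * ZMod.stdAddChar j := by
        rw [← AddChar.map_add_eq_mul, ht]
        congr 1
        ring
      rw [this]
      field_simp
    have hnv := congrArg norm hval
    rw [hfac, norm_mul, norm_mul, norm_mul, hnq, CatMap.norm_stdAddChar, one_mul, hFn,
      ← mul_assoc, inv_mul_cancel_left₀ hq0] at hnv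
    have hsup : ‖ψ (Q + (p : ZMod (p ^ (2 * k))) ^ k * (t.val : ZMod (p ^ (2 * k))))‖
        ≤ CatMap.supNorm p k ψ :=
      le_ciSup (f := fun Q => ‖ψ Q‖) (Set.finite_range _).bddAbove _
    refine le_trans ?_ hsup
    rw [hnv]
    have e : (p : ℝ) ^ (2 * k) = (((p ^ k : ℕ) : ℝ)) ^ 2 := by push_cast; ring
    rw [e, mul_comm 2 A, mul_assoc]
    exact mul_le_mul_of_nonneg_left hj hA0
  · refine ciSup_le fun Q => ?_
    have hval := CatMap.apply_add_eq_sum_fiber hV Q 0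
    rw [ZMod.val_zero, Nat.cast_zero, mul_zero, add_zero] at hval
    rw [hval, norm_mul, hnq]
    -- The fibre has `1 + χ ≤ 2` points, so the triangle inequality suffices.
    have hcard : ((CatMap.fiber p k D C Q).card : ℝ) ≤ 2 := by
      have h1 := CatMap.card_fiber hp2 hk0 hC h Q
      have h2 : ((CatMap.fiber p k D C Q).card : ℤ) ≤ 2 := by
        rw [h1]
        set a := (D : ZMod p) * CatMap.redToPrime p k hk0 Q ^ 2 - C
        rcases eq_or_ne a 0 with ha | ha
        · rw [ha]; simp
        · rcases quadraticChar_dichotomy ha with h | h <;> rw [h] <;> norm_num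
      exact_mod_cast h2
    calc ((p : ℝ) ^ k)⁻¹ * ‖∑ s ∈ CatMap.fiber p k D C Q, ZMod.stdAddChar (s * 0) *
          CatMap.zetaCoeff p k ![(s.val : ZMod (p ^ (2 * k))), Q] ψ‖
        ≤ ((p : ℝ) ^ k)⁻¹ * ∑ s ∈ CatMap.fiber p k D C Q, (p : ℝ) ^ k * A := by
          refine mul_le_mul_of_nonneg_left (norm_sum_le_of_le _ fun s hs => ?_) (by positivity)
          rw [norm_mul, CatMap.norm_stdAddChar, one_mul, coeff Q s hs]
      _ = (CatMap.fiber p k D C Q).card * A := by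
          rw [Finset.sum_const, nsmul_eq_mul]
          field_simp
      _ ≤ 2 * A := mul_le_mul_of_nonneg_right hcard hA0
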